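/- Let $n,m_1,m_2$ be positive integers, $m=m_1+m_2$, $j=\mathrm{diag}(I_{m_1},-I_{m_2})$. Let $A$, $S_0$ be complex $n\times n$ matrices and $\Pi_0=[\vartheta_1\ \ \vartheta_2]$ a complex $n\times m$ matrix, with blocks $\vartheta_1$ of size $n\times m_1$ and $\vartheta_2$ of size $n\times m_2$. Assume that the triple $\{A,S_0,\Pi_0\}$ is strongly admissible, that is, $$\det A\neq 0,\qquad S_0>0,\qquad AS_0-S_0A^*=\mathrm{i}\,\Pi_0 j\Pi_0^*,\qquad \sigma(A)\subset\{\lambda\in\mathbb C:\ \Im\lambda>0\},\qquad \mathrm{i}\notin\sigma(A).$$ For $k\ge 0$ define $$\Pi_{k+1}=\Pi_k+\mathrm{i}A^{-1}\Pi_k j,\qquad S_{k+1}=S_k+A^{-1}S_k(A^*)^{-1}+A^{-1}\Pi_k\Pi_k^*(A^*)^{-1},$$ and let $\{C_k\}_{k\ge0}$ be the potential determined by the triple, $$C_k=I_m+\Pi_k^*S_k^{-1}\Pi_k-\Pi_{k+1}^*S_{k+1}^{-1}\Pi_{k+1}.$$ Then $S_k>0$, $C_k>0$ and $C_kjC_k=j$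 for all $k\ge0$, so that $\{C_k\}$ is the potential of a self-adjoint discrete Dirac system $$y_{k+1}(z)=(I_m+\mathrm{i}zjC_k)\,y_k(z)\qquad(k\ge0).$$ For every $z\in\mathbb R$ this system has a unique Jost solution, that is, a unique $m\times m$ matrix solution $\{F_k(z)\}_{k\ge 0}$ with $F_k(z)=(I_m+\mathrm{i}zj)^k(I_m+o(1))$ as $k\to\infty$. For every $z\in\mathbb R$ the lower right $m_2\times m_2$ block of $F_0(z)$ is invertible, so that the reflection coefficient $$\mathcal R(z)=\begin{bmatrix}I_{m_1}&0\end{bmatrix}F_0(z)\begin{bmatrix}0\\ I_{m_2}\end{bmatrix}\left(\begin{bmatrix}0&I_{m_2}\end{bmatrix}F_0(z)\begin{bmatrix}0\\ I_{m_2}\end{bmatrix}\right)^{-1}$$ is well defined. Moreover, with $A^\times=A+\mathrm{i}\vartheta_2\vartheta_2^*S_0^{-1}$, the matrix $I_n+zA^\times$ is invertible and $$\mathcal R(z)=-\mathrm{i}z\,\vartheta_1^*S_0^{-1}(I_n+zA^\times)^{-1}\vartheta_2\qquad(z\in\mathbb R).$$ -/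

import Mathlib

open Matrix Filter Topology
open scoped ComplexOrder

namespace DiscreteDirac

variable {n m₁ m₂ : ℕ}

/-- The signature matrix `j = diag(I, -I)`. -/
def sgn (m₁ m₂ : ℕ) : Matrix (Fin m₁ ⊕ Fin m₂) (Fin m₁ ⊕ Fin m₂) ℂ :=
  Matrix.fromBlocks 1 0 0 (-1)

/-- The sequence `C` is a potential of a self-adjoint discrete Dirac system:
every `C k` is positive definite and `j`-unitary. -/
def IsDiracPotential
    (C : ℕ → Matrix (Fin m₁ ⊕ Fin m₂) (Fin m₁ ⊕ Fin m₂) ℂ) : Prop :=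
  ∀ k, (C k).PosDef ∧ C k * sgn m₁ m₂ * C k = sgn m₁ m₂

/-- `y` solves the discrete Dirac system `y (k+1) = (I + i z j C k) y k` (matrix-valued solutions,
column by column). -/
def IsDiracSolution
    (C : ℕ → Matrix (Fin m₁ ⊕ Fin m₂) (Fin m₁ ⊕ Fin m₂) ℂ) (z : ℂ)
    (y : ℕ → Matrix (Fin m₁ ⊕ Fin m₂) (Fin m₁ ⊕ Fin m₂) ℂ) : Prop :=
  ∀ k, y (k + 1) = (1 + (Complex.I * z) • (sgn m₁ m₂ * C k)) * y k

/-- `F` is a Jost solution: for every real `z`, `F z` solves the Dirac system and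
`F z k = (I + i z j) ^ k (I + o(1))` as `k → ∞`. -/
def IsJostSolution
    (C : ℕ → Matrix (Fin m₁ ⊕ Fin m₂) (Fin m₁ ⊕ Fin m₂) ℂ)
    (F : ℝ → ℕ → Matrix (Fin m₁ ⊕ Fin m₂) (Fin m₁ ⊕ Fin m₂) ℂ) : Prop :=
  ∀ z : ℝ, IsDiracSolution C (z : ℂ) (F z) ∧
    ∃ E : ℕ → Matrix (Fin m₁ ⊕ Fin m₂) (Fin m₁ ⊕ Fin m₂) ℂ,
      Tendsto E atTop (𝓝 0) ∧
      ∀ k, F z k = (1 + (Complex.I * (z : ℂ)) • sgn m₁ m₂) ^ k * (1 + E k)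

/-- The reflection coefficient, in terms of the blocks of the value at `k = 0` of the
Jost solution `F`. -/
noncomputable def reflectionCoefficient
    (F : ℝ → ℕ → Matrix (Fin m₁ ⊕ Fin m₂) (Fin m₁ ⊕ Fin m₂) ℂ) (z : ℝ) :
    Matrix (Fin m₁) (Fin m₂) ℂ :=
  (F z 0).toBlocks₁₂ * ((F z 0).toBlocks₂₂)⁻¹

/-- Admissible triples (self-adjoint case). -/
structure IsAdmissible (A S₀ : Matrix (Fin n) (Fin n) ℂ)
    (P₀ : Matrix (Fin n) (Fin m₁ ⊕ Fin m₂) ℂ) : Prop where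
  det_ne_zero : A.det ≠ 0
  posDef : S₀.PosDef
  identity : A * S₀ - S₀ * Aᴴ = Complex.I • (P₀ * sgn m₁ m₂ * P₀ᴴ)

/-- Strongly admissible triples (self-adjoint case): the spectrum of `A` lies in the open upper
half-plane and does not contain `i`. -/
structure IsStronglyAdmissible (A S₀ : Matrix (Fin n) (Fin n) ℂ)
    (P₀ : Matrix (Fin n) (Fin m₁ ⊕ Fin m₂) ℂ) : Prop
    extends IsAdmissible A S₀ P₀ where
  spectrum_upper : ∀ μ ∈ spectrum ℂ A, 0 < μ.im
  I_notMem_spectrum : Complex.I ∉ spectrum ℂ A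

/-- The sequence `Π_k`. -/
noncomputable def seqP (A : Matrix (Fin n) (Fin n) ℂ)
    (P₀ : Matrix (Fin n) (Fin m₁ ⊕ Fin m₂) ℂ) :
    ℕ → Matrix (Fin n) (Fin m₁ ⊕ Fin m₂) ℂ
  | 0 => P₀
  | k + 1 => seqP A P₀ k + Complex.I • (A⁻¹ * seqP A P₀ k * sgn m₁ m₂)

/-- The sequence `S_k`. -/
noncomputable def seqS (A S₀ : Matrix (Fin n) (Fin n) ℂ)
    (P₀ : Matrix (Fin n) (Fin m₁ ⊕ Fin m₂) ℂ) :
    ℕ → Matrix (Fin n) (Fin n) ℂ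
  | 0 => S₀
  | k + 1 => seqS A S₀ P₀ k + A⁻¹ * seqS A S₀ P₀ k * (Aᴴ)⁻¹
      + A⁻¹ * seqP A P₀ k * (seqP A P₀ k)ᴴ * (Aᴴ)⁻¹

/-- The potential `C_k` determined by the triple. -/
noncomputable def potential (A S₀ : Matrix (Fin n) (Fin n) ℂ)
    (P₀ : Matrix (Fin n) (Fin m₁ ⊕ Fin m₂) ℂ) (k : ℕ) :
    Matrix (Fin m₁ ⊕ Fin m₂) (Fin m₁ ⊕ Fin m₂) ℂ :=
  1 + (seqP A P₀ k)ᴴ * (seqS A S₀ P₀ k)⁻¹ * seqP A P₀ k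
    - (seqP A P₀ (k + 1))ᴴ * (seqS A S₀ P₀ (k + 1))⁻¹ * seqP A P₀ (k + 1)

end DiscreteDirac

/-!
With `w_k(z) = I - i z j Π_kᴴ S_k⁻¹ (I + z A)⁻¹ Π_k` one has the intertwining relation
`w_{k+1}(z) (I + i z j) = (I + i z j C_k) w_k(z)` (`darboux_intertwine`), a consequence of the
identity `A S_k - S_k Aᴴ = i Π_k j Π_kᴴ`, which is preserved by the recursions. Hence
`w_k(z) (I + i z j) ^ k` is an explicit fundamental solution. For real `z` the matrices `w_k(z)` are
`j`-unitary (`darboux_jUnitary`); the relation at `z = 1` then gives `C_k j C_k = j`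
(`step_jUnitary`). Nonnegativity of `C_k` comes from a Schur complement (`step_posSemidef`), and it
is strict because `C_k` is invertible.

For the asymptotics put `B = I + i A⁻¹` and let `V = (A + i)⁻¹ (A - i)` be the Cayley transform.
Then `Π_k = B ^ k [ϑ₁, V ^ k ϑ₂]` and `S_k = B ^ k Q_k (B ^ k)ᴴ`, where `Q_k` is `S₀` plus a partial
sum of `∑ 2 V ^ i N ϑ₂ ϑ₂ᴴ Nᴴ (V ^ i)ᴴ`, `N = (A + i)⁻¹`. As `σ(A)` lies in the upper half-plane, `V`
has spectral radius less than one, so `V ^ k → 0` and `Q_k` converges to a positive definite `Q`.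
The factor `B ^ k` drops out of `w_k(z)`, so `w_k(z)` tends to a block diagonal `j`-unitary matrix
`w_∞ = diag(b, I)`. For real `z` the diagonal entries of `I + i z j` have equal modulus, so
conjugation by its powers is bounded, and `F_k = w_k(z) (I + i z j) ^ k w_∞⁻¹` is the only Jost
solution (`exists_jost`).

The factor `w_∞⁻¹` does not touch the second block column, so the reflection coefficient is the
quotient of the upper right and lower right blocks of `w₀(z)`. The latter is invertible because
`w₀(z)` is `j`-unitary, and a Woodbury-type identity turns the quotient into the stated formula.
-/

namespace DiscreteDirac

/-! ### The Darboux matrix function and one step of the recursion -/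

section Algebra

variable {ι κ : Type*} [Fintype ι] [DecidableEq ι] [Fintype κ] [DecidableEq κ]

/-- The Darboux (transfer) matrix function `w(z) = I - i z J Pᴴ S⁻¹ (I + z A)⁻¹ P`. With
`λ = -1/z` it is the usual `I - i J Pᴴ S⁻¹ (A - λ I)⁻¹ P`, in a form that also makes sense at
`z = 0`. -/
noncomputable def darboux (A S : Matrix ι ι ℂ) (J : Matrix κ κ ℂ) (P : Matrix ι κ ℂ) (z : ℂ) :
    Matrix κ κ ℂ :=
  1 - (Complex.I * z) • (J * (Pᴴ * S⁻¹ * (1 + z • A)⁻¹ * P))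

variable {A S S' : Matrix ι ι ℂ} {J : Matrix κ κ ℂ} {P P' : Matrix ι κ ℂ}

/-- One step of the recursion preserves the matrix identity of the triple. -/
theorem identity_step (hA : IsUnit A.det) (hJ : J * J = 1) (hJs : Jᴴ = J)
    (hid : A * S - S * Aᴴ = Complex.I • (P * J * Pᴴ))
    (hP' : P' = P + Complex.I • (A⁻¹ * P * J))
    (hS' : S' = S + A⁻¹ * S * (Aᴴ)⁻¹ + A⁻¹ * P * Pᴴ * (Aᴴ)⁻¹) :
    A * S' - S' * Aᴴ = Complex.I • (P' * J * P'ᴴ) := by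
  have hAs : IsUnit (Aᴴ).det := by rw [det_conjTranspose]; exact hA.star
  have hJJ : ∀ X : Matrix κ ι ℂ, J * (J * X) = X := fun X => by
    rw [← Matrix.mul_assoc, hJ, Matrix.one_mul]
  have hid2 := congrArg (fun M => A⁻¹ * M * (Aᴴ)⁻¹) hid
  subst hP' hS'
  linear_combination (norm := skip) hid + hid2
  simp only [Matrix.mul_add, Matrix.add_mul, Matrix.mul_sub, Matrix.sub_mul, Matrix.mul_assoc,
    Matrix.smul_mul, Matrix.mul_smul, smul_add, smul_smul, conjTranspose_add,
    conjTranspose_smul, conjTranspose_mul, hJs, hJJ, conjTranspose_nonsing_inv,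
    Matrix.mul_nonsing_inv_cancel_left _ _ hA, Matrix.nonsing_inv_mul_cancel_left _ _ hA,
    Matrix.mul_nonsing_inv _ hAs, Matrix.nonsing_inv_mul _ hAs, Matrix.mul_one,
    Complex.star_def, Complex.conj_I, Complex.I_mul_I, mul_neg]
  have hI : Complex.I ^ 2 = -1 := Complex.I_sq
  match_scalars <;> grind

/-- The relation that makes the Darboux matrix functions intertwine: it combines the recursions
for `P'` and `S'` with the matrix identity for `S`. -/
theorem transfer_identity (hA : IsUnit A.det) (hJ : J * J = 1)
    (hid : A * S - S * Aᴴ = Complex.I • (P * J * Pᴴ))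
    (hP' : P' = P + Complex.I • (A⁻¹ * P * J))
    (hS' : S' = S + A⁻¹ * S * (Aᴴ)⁻¹ + A⁻¹ * P * Pᴴ * (Aᴴ)⁻¹) :
    Complex.I • (P' * J * Pᴴ) + S' * Aᴴ = (A + A⁻¹) * S := by
  have hAs : IsUnit (Aᴴ).det := by rw [det_conjTranspose]; exact hA.star
  have hJJ : ∀ X : Matrix κ ι ℂ, J * (J * X) = X := fun X => by
    rw [← Matrix.mul_assoc, hJ, Matrix.one_mul]
  subst hP' hS'
  linear_combination (norm := skip) -hid
  simp only [Matrix.add_mul, Matrix.mul_assoc, Matrix.smul_mul, smul_add, smul_smul, hJJ,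
    Matrix.nonsing_inv_mul _ hAs, Matrix.mul_one, Complex.I_mul_I]
  module

/-- The Darboux matrix functions before and after a step of the recursion intertwine the free
system factor `1 + i z J` with the system factor `1 + i z J C`. -/
theorem darboux_intertwine (hA : IsUnit A.det) (hJ : J * J = 1) (hJs : Jᴴ = J)
    (hSu : IsUnit S.det) (hSu' : IsUnit S'.det)
    (hid : A * S - S * Aᴴ = Complex.I • (P * J * Pᴴ))
    (hP' : P' = P + Complex.I • (A⁻¹ * P * J))
    (hS' : S' = S + A⁻¹ * S * (Aᴴ)⁻¹ + A⁻¹ * P * Pᴴ * (Aᴴ)⁻¹)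
    {z : ℂ} (hz : IsUnit (1 + z • A).det) :
    darboux A S' J P' z * (1 + (Complex.I * z) • J) =
      (1 + (Complex.I * z) • (J * (1 + Pᴴ * S⁻¹ * P - P'ᴴ * S'⁻¹ * P'))) *
        darboux A S J P z := by
  have hJJ : ∀ X : Matrix κ κ ℂ, J * (J * X) = X := fun X => by
    rw [← Matrix.mul_assoc, hJ, Matrix.one_mul]
  obtain ⟨Y, hY⟩ : ∃ Y, Y = (1 + z • A)⁻¹ * P := ⟨_, rfl⟩
  obtain ⟨Y', hY'⟩ : ∃ Y', Y' = (1 + z • A)⁻¹ * P' := ⟨_, rfl⟩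
  obtain ⟨T, hT⟩ : ∃ T, T = S⁻¹ * Y := ⟨_, rfl⟩
  have hST : S * T = Y := by rw [hT, Matrix.mul_nonsing_inv_cancel_left _ _ hSu]
  have hYP : (1 + z • A) * Y = P := by rw [hY, Matrix.mul_nonsing_inv_cancel_left _ _ hz]
  have hYP' : (1 + z • A) * Y' = P' := by rw [hY', Matrix.mul_nonsing_inv_cancel_left _ _ hz]
  have hw : darboux A S J P z = 1 - (Complex.I * z) • (J * (Pᴴ * T)) := by
    simp only [darboux, hT, hY, Matrix.mul_assoc]
  have hw' : darboux A S' J P' z = 1 - (Complex.I * z) • (J * (P'ᴴ * (S'⁻¹ * Y'))) := by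
    simp only [darboux, hY', Matrix.mul_assoc]
  -- the terms with `S⁻¹` on the left, simplified by the matrix identity for `S`
  have hX : Pᴴ * S⁻¹ * P - (Complex.I * z) • (Pᴴ * S⁻¹ * (P * J * (Pᴴ * T))) =
      Pᴴ * T + z • (Pᴴ * Aᴴ * T) := by
    have e : P - (Complex.I * z) • (P * J * (Pᴴ * T)) = Y + z • (S * (Aᴴ * T)) := by
      have := congrArg (fun M => M * T) hid
      linear_combination (norm := skip) z • this - hYP - z • congrArg (fun M => A * M) hST
      simp only [Matrix.add_mul, Matrix.sub_mul, Matrix.mul_assoc, Matrix.smul_mul, smul_smul,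
        smul_sub, Matrix.one_mul]
      module
    have := congrArg (fun M => Pᴴ * (S⁻¹ * M)) e
    simp only [Matrix.mul_add, Matrix.mul_sub, Matrix.mul_smul,
      Matrix.nonsing_inv_mul_cancel_left _ _ hSu, ← hT] at this
    simpa only [Matrix.mul_assoc] using this
  -- the terms with `S'⁻¹` on the left, simplified by `transfer_identity`
  have hX' : P' - Y' * (1 + (Complex.I * z) • J) =
      z • (Complex.I • (P' * J * (Pᴴ * T)) + S' * (Aᴴ * T)) := by
    have e1 : Complex.I • (P' * J * (Pᴴ * T)) + S' * (Aᴴ * T) = (A + A⁻¹) * Y := by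
      have := congrArg (fun M => M * T) (transfer_identity hA hJ hid hP' hS')
      simp only [Matrix.add_mul, Matrix.smul_mul, Matrix.mul_assoc, hST] at this
      simpa only [Matrix.mul_assoc, Matrix.add_mul] using this
    rw [e1]
    -- `1 + z A` is invertible, so the resolvents may be cleared from the equation
    have e2 : (1 + z • A) * (P' - Y' * (1 + (Complex.I * z) • J)) =
        (1 + z • A) * (z • ((A + A⁻¹) * Y)) := by
      rw [Matrix.mul_sub, ← Matrix.mul_assoc, hYP', Matrix.mul_smul, ← Matrix.mul_assoc,
        show (1 + z • A) * (A + A⁻¹) = (A + A⁻¹) * (1 + z • A) by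
          simp only [Matrix.add_mul, Matrix.mul_add, Matrix.smul_mul, Matrix.mul_smul,
            Matrix.mul_one, Matrix.one_mul, Matrix.mul_nonsing_inv _ hA,
            Matrix.nonsing_inv_mul _ hA, smul_add]; abel,
        Matrix.mul_assoc, hYP, hP']
      simp only [Matrix.add_mul, Matrix.mul_add, Matrix.smul_mul, Matrix.mul_smul, smul_add,
        smul_smul, Matrix.mul_one, Matrix.one_mul, Matrix.mul_assoc, hJ,
        Matrix.mul_nonsing_inv_cancel_left _ _ hA]
      have hI : Complex.I ^ 2 = -1 := Complex.I_sq
      match_scalars <;> grind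
    have := congrArg (fun M => (1 + z • A)⁻¹ * M) e2
    simpa only [Matrix.nonsing_inv_mul_cancel_left _ _ hz] using this
  have hPA : P'ᴴ * Aᴴ = Pᴴ * Aᴴ - Complex.I • (J * Pᴴ) := by
    rw [← conjTranspose_mul, hP']
    simp only [Matrix.mul_add, Matrix.mul_smul, Matrix.mul_assoc, conjTranspose_add,
      conjTranspose_smul, conjTranspose_mul, hJs, Matrix.mul_nonsing_inv_cancel_left _ _ hA,
      Complex.star_def, Complex.conj_I]
    module
  have hX'' := congrArg (fun M => J * (P'ᴴ * (S'⁻¹ * M))) hX'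
  have hPA' := congrArg (fun M => J * (M * T)) hPA
  rw [hw, hw']
  linear_combination (norm := skip) (Complex.I * z) • hX'' -
    (Complex.I * z) • congrArg (fun M => J * M) hX + (Complex.I * z ^ 2) • hPA'
  simp only [Matrix.add_mul, Matrix.mul_add, Matrix.sub_mul, Matrix.mul_sub, Matrix.smul_mul,
    Matrix.mul_smul, smul_add, smul_sub, smul_smul, Matrix.mul_one, Matrix.one_mul,
    Matrix.mul_assoc, hJJ, Matrix.nonsing_inv_mul_cancel_left _ _ hSu']
  have hI : Complex.I ^ 2 = -1 := Complex.I_sq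
  match_scalars <;> grind

/-- On the real line the Darboux matrix function is `J`-unitary. -/
theorem darboux_jUnitary (hJ : J * J = 1) (hJs : Jᴴ = J) (hS : S.PosDef)
    (hid : A * S - S * Aᴴ = Complex.I • (P * J * Pᴴ))
    {z : ℝ} (hz : IsUnit (1 + (z : ℂ) • A).det) :
    (darboux A S J P z)ᴴ * J * darboux A S J P z = J := by
  have hJJ : ∀ X : Matrix κ κ ℂ, J * (J * X) = X := fun X => by
    rw [← Matrix.mul_assoc, hJ, Matrix.one_mul]
  have hSu : IsUnit S.det := (Matrix.isUnit_iff_isUnit_det _).1 hS.isUnit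
  obtain ⟨Y, hY⟩ : ∃ Y, Y = (1 + (z : ℂ) • A)⁻¹ * P := ⟨_, rfl⟩
  obtain ⟨T, hT⟩ : ∃ T, T = S⁻¹ * Y := ⟨_, rfl⟩
  have hST : S * T = Y := by rw [hT, Matrix.mul_nonsing_inv_cancel_left _ _ hSu]
  have hTS : Tᴴ * S = Yᴴ := by
    rw [← hST, conjTranspose_mul, hS.isHermitian.eq]
  have hYP : P = (1 + (z : ℂ) • A) * Y := by
    rw [hY, Matrix.mul_nonsing_inv_cancel_left _ _ hz]
  have hYP2 : Pᴴ = Yᴴ * (1 + (z : ℂ) • Aᴴ) := by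
    rw [hYP, conjTranspose_mul]; simp
  have hw : darboux A S J P z = 1 - (Complex.I * z) • (J * (Pᴴ * T)) := by
    simp only [darboux, hT, hY, Matrix.mul_assoc]
  have hws : (darboux A S J P z)ᴴ = 1 + (Complex.I * z) • (Tᴴ * P * J) := by
    rw [hw]
    simp [conjTranspose_mul, hJs]
  have h1 := congrArg (fun M => Tᴴ * M * T) hid
  have h2 : Tᴴ * P = Tᴴ * Y + (z : ℂ) • (Tᴴ * (A * Y)) := by
    nth_rw 1 [hYP]; simp [Matrix.add_mul, Matrix.mul_add]
  have h3 : Pᴴ * T = Yᴴ * T + (z : ℂ) • (Yᴴ * (Aᴴ * T)) := by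
    rw [hYP2]; simp [Matrix.add_mul, Matrix.mul_add, Matrix.mul_assoc]
  have h4 : Tᴴ * Y = Yᴴ * T := by rw [← hTS, ← hST, Matrix.mul_assoc]
  have h5 : Tᴴ * (P * (J * (Pᴴ * T))) =
      -Complex.I • (Tᴴ * (A * Y) - Yᴴ * (Aᴴ * T)) := by
    simp only [Matrix.mul_sub, Matrix.sub_mul, Matrix.mul_assoc, hST, Matrix.mul_smul,
      Matrix.smul_mul] at h1
    rw [← Matrix.mul_assoc _ S, hTS] at h1
    rw [h1, smul_smul]; simp
  rw [hws, hw]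
  simp only [Matrix.add_mul, Matrix.mul_sub, Matrix.smul_mul, Matrix.mul_smul, Matrix.mul_one,
    Matrix.one_mul, Matrix.mul_assoc, hJ, hJJ, h5]
  rw [h2, h3, h4]
  have hI : Complex.I ^ 2 = -1 := Complex.I_sq
  match_scalars <;> grind

theorem isUnit_of_jUnitary {J W : Matrix κ κ ℂ} (hJ : J * J = 1) (hW : Wᴴ * J * W = J) :
    IsUnit W :=
  IsUnit.of_mul_eq_one_right (J * Wᴴ * J) (by
    rw [Matrix.mul_assoc, Matrix.mul_assoc, ← Matrix.mul_assoc Wᴴ, hW, hJ])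

/-- Positivity is a Schur complement: `P'ᴴ S'⁻¹ P'` is subtracted from the lower right block of a
sum of two positive semidefinite block matrices, one built from `S` and `P` and the other carrying
the increments of the recursion. -/
theorem step_posSemidef (hJ : J * J = 1) (hJs : Jᴴ = J)
    (hS : S.PosDef) (hS'p : S'.PosDef)
    (hP' : P' = P + Complex.I • (A⁻¹ * P * J))
    (hS' : S' = S + A⁻¹ * S * (Aᴴ)⁻¹ + A⁻¹ * P * Pᴴ * (Aᴴ)⁻¹) :
    (1 + Pᴴ * S⁻¹ * P - P'ᴴ * S'⁻¹ * P').PosSemidef := by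
  let := hS.isUnit.invertible
  let := hS'p.isUnit.invertible
  let : Invertible (1 : Matrix κ κ ℂ) := invertibleOne
  have hJJ : ∀ X : Matrix κ ι ℂ, J * (J * X) = X := fun X => by
    rw [← Matrix.mul_assoc, hJ, Matrix.one_mul]
  rw [← PosDef.fromBlocks₁₁ _ _ hS'p]
  have h1 : (fromBlocks S P Pᴴ (Pᴴ * S⁻¹ * P)).PosSemidef := by
    rw [PosDef.fromBlocks₁₁ _ _ hS, sub_self]
    exact PosSemidef.zero
  have h2 : (fromBlocks (A⁻¹ * S * (Aᴴ)⁻¹ + A⁻¹ * P * Pᴴ * (Aᴴ)⁻¹)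
      (Complex.I • (A⁻¹ * P * J)) (Complex.I • (A⁻¹ * P * J))ᴴ 1).PosSemidef := by
    rw [PosDef.fromBlocks₂₂ _ _ PosDef.one]
    have := hS.posSemidef.mul_mul_conjTranspose_same A⁻¹
    rw [conjTranspose_nonsing_inv] at this
    refine (congrArg PosSemidef ?_).mpr this
    simp [conjTranspose_mul, conjTranspose_nonsing_inv, hJs, Matrix.mul_assoc, hJJ, smul_smul]
  have := h1.add h2
  rw [fromBlocks_add, ← conjTranspose_add, ← hP', ← add_assoc, ← hS', add_comm _ (1 : Matrix κ κ ℂ)]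
    at this
  exact this

/-- The intertwining relation at `z = 1` turns the `J`-unitarity of the Darboux matrices into
that of the potential. -/
theorem step_jUnitary (hA : IsUnit A.det) (hJ : J * J = 1) (hJs : Jᴴ = J)
    (hS : S.PosDef) (hS'p : S'.PosDef)
    (hid : A * S - S * Aᴴ = Complex.I • (P * J * Pᴴ))
    (hP' : P' = P + Complex.I • (A⁻¹ * P * J))
    (hS' : S' = S + A⁻¹ * S * (Aᴴ)⁻¹ + A⁻¹ * P * Pᴴ * (Aᴴ)⁻¹)
    (hz : IsUnit (1 + A).det) {C : Matrix κ κ ℂ}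
    (hC : C = 1 + Pᴴ * S⁻¹ * P - P'ᴴ * S'⁻¹ * P') :
    C * J * C = J := by
  have hz' : IsUnit (1 + ((1 : ℝ) : ℂ) • A).det := by simpa using hz
  have hu : IsUnit S.det := (Matrix.isUnit_iff_isUnit_det _).1 hS.isUnit
  have hu' : IsUnit S'.det := (Matrix.isUnit_iff_isUnit_det _).1 hS'p.isUnit
  have hw := darboux_jUnitary hJ hJs hS hid hz'
  have hw' := darboux_jUnitary hJ hJs hS'p (identity_step hA hJ hJs hid hP' hS') hz'
  have hint := darboux_intertwine hA hJ hJs hu hu' hid hP' hS' hz'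
  rw [← hC] at hint
  have hCs : Cᴴ = C := by
    rw [hC]
    exact (step_posSemidef hJ hJs hS hS'p hP' hS').isHermitian
  set W := darboux A S J P ((1 : ℝ) : ℂ)
  set W' := darboux A S' J P' ((1 : ℝ) : ℂ)
  simp only [Complex.ofReal_one, mul_one] at hint
  have hJJ : ∀ X : Matrix κ κ ℂ, J * (J * X) = X := fun X => by
    rw [← Matrix.mul_assoc, hJ, Matrix.one_mul]
  have hD : (1 + Complex.I • J)ᴴ * J * (1 + Complex.I • J) = J + J := by
    simp [Matrix.add_mul, Matrix.mul_add, hJ, hJs, smul_smul]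
  have hDC : (1 + Complex.I • (J * C))ᴴ * J * (1 + Complex.I • (J * C)) = J + C * J * C := by
    simp [Matrix.add_mul, Matrix.mul_add, hJ, hJs, hJJ, hCs, smul_smul, conjTranspose_mul,
      Matrix.mul_assoc]
  have hWu := isUnit_of_jUnitary hJ hw
  -- both sides are `Yᴴ J Y`, where `Y` is either side of the intertwining relation
  have key : Wᴴ * (J + C * J * C) * W = Wᴴ * (J + J) * W := by
    calc Wᴴ * (J + C * J * C) * W
        = ((1 + Complex.I • (J * C)) * W)ᴴ * J * ((1 + Complex.I • (J * C)) * W) := by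
          rw [← hDC, conjTranspose_mul]; simp only [Matrix.mul_assoc]
      _ = (1 + Complex.I • J)ᴴ * (W'ᴴ * J * W') * (1 + Complex.I • J) := by
          rw [← hint, conjTranspose_mul]; simp only [Matrix.mul_assoc]
      _ = Wᴴ * (J + J) * W := by
          rw [hw', hD, Matrix.mul_add, Matrix.add_mul, hw]
  have := hWu.star.mul_left_cancel (hWu.mul_right_cancel key)
  exact add_left_cancel this

/-- The Darboux matrix function is invariant under changes of basis commuting with `A`. -/
theorem darboux_conj {M : Matrix ι ι ℂ} (hM : IsUnit M) (hMA : Commute M A) {z : ℂ}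
    (hz : IsUnit (1 + z • A)) :
    darboux A (M * S * Mᴴ) J (M * P) z = darboux A S J P z := by
  have hMd : IsUnit M.det := (Matrix.isUnit_iff_isUnit_det _).1 hM
  have hMs : IsUnit (Mᴴ).det := by rw [det_conjTranspose]; exact hMd.star
  have hzd := (Matrix.isUnit_iff_isUnit_det _).1 hz
  have hc : M * (1 + z • A) = (1 + z • A) * M := by
    simp [Matrix.mul_add, Matrix.add_mul, hMA.eq]
  have hc' : (1 + z • A)⁻¹ * (M * P) = M * ((1 + z • A)⁻¹ * P) := by
    have : (1 + z • A) * (M * ((1 + z • A)⁻¹ * P)) = M * P := by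
      rw [← Matrix.mul_assoc, ← hc, Matrix.mul_assoc, Matrix.mul_nonsing_inv_cancel_left _ _ hzd]
    rw [← this, Matrix.nonsing_inv_mul_cancel_left _ _ hzd]
  simp only [darboux, Matrix.mul_inv_rev, conjTranspose_mul, Matrix.mul_assoc, hc',
    Matrix.nonsing_inv_mul_cancel_left _ _ hMd, Matrix.mul_nonsing_inv_cancel_left _ _ hMs]

theorem darboux_tendsto {Sₖ : ℕ → Matrix ι ι ℂ} {Pₖ : ℕ → Matrix ι κ ℂ} (hS : IsUnit S.det)
    (hSₖ : Tendsto Sₖ atTop (𝓝 S)) (hPₖ : Tendsto Pₖ atTop (𝓝 P)) (z : ℂ) :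
    Tendsto (fun k => darboux A (Sₖ k) J (Pₖ k) z) atTop (𝓝 (darboux A S J P z)) := by
  have hinv : Tendsto (fun k => (Sₖ k)⁻¹) atTop (𝓝 S⁻¹) := by
    refine (continuousAt_matrix_inv S ?_).tendsto.comp hSₖ
    rw [Ring.inverse_eq_inv']
    exact continuousAt_inv₀ hS.ne_zero
  have hcont : Continuous fun p : Matrix ι ι ℂ × Matrix ι κ ℂ =>
      1 - (Complex.I * z) • (J * (p.2ᴴ * p.1 * (1 + z • A)⁻¹ * p.2)) := by
    fun_prop
  have := (hcont.tendsto (S⁻¹, P)).comp (hinv.prodMk_nhds hPₖ)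
  simpa only [darboux, Function.comp_def] using this

end Algebra

/-! ### Positivity and `j`-unitarity along the sequence -/

variable {n m₁ m₂ : ℕ}

theorem sgn_mul_self : sgn m₁ m₂ * sgn m₁ m₂ = 1 := by
  simp [sgn, fromBlocks_multiply]

theorem sgn_conjTranspose : (sgn m₁ m₂)ᴴ = sgn m₁ m₂ := by
  simp [sgn, fromBlocks_conjTranspose]

theorem fromCols_mul_sgn (X : Matrix (Fin n) (Fin m₁) ℂ) (Y : Matrix (Fin n) (Fin m₂) ℂ) :
    fromCols X Y * sgn m₁ m₂ = fromCols X (-Y) := by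
  simp [sgn, fromCols_mul_fromBlocks]

variable {A S₀ : Matrix (Fin n) (Fin n) ℂ}

theorem isUnit_linear_of_notMem_spectrum {a b : ℂ} (hb : b ≠ 0) (h : -a / b ∉ spectrum ℂ A) :
    IsUnit (a • (1 : Matrix (Fin n) (Fin n) ℂ) + b • A) := by
  rw [spectrum.notMem_iff, Algebra.algebraMap_eq_smul_one] at h
  have := h.smul (Units.mk0 (-b) (neg_ne_zero.2 hb))
  convert this using 1
  rw [Units.smul_def, Units.val_mk0, smul_sub, smul_smul]
  rw [show -b * (-a / b) = a by field_simp]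
  simp

theorem isUnit_one_add_real_smul (hA : ∀ μ ∈ spectrum ℂ A, 0 < μ.im) (z : ℝ) :
    IsUnit (1 + (z : ℂ) • A) := by
  by_cases hz : z = 0
  · simp [hz]
  · have := isUnit_linear_of_notMem_spectrum (A := A) (a := 1) (b := z)
      (Complex.ofReal_ne_zero.2 hz) fun h => by
        have := hA _ h
        rw [show (-1 / (z : ℂ)) = ((-1 / z : ℝ) : ℂ) by push_cast; rfl, Complex.ofReal_im] at this
        exact lt_irrefl _ this
    simpa using this

section Admissible

variable {P₀ : Matrix (Fin n) (Fin m₁ ⊕ Fin m₂) ℂ}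

theorem IsAdmissible.seq_identity (h : IsAdmissible A S₀ P₀) (k : ℕ) :
    A * seqS A S₀ P₀ k - seqS A S₀ P₀ k * Aᴴ =
      Complex.I • (seqP A P₀ k * sgn m₁ m₂ * (seqP A P₀ k)ᴴ) := by
  induction k with
  | zero => exact h.identity
  | succ k ih =>
    exact identity_step h.det_ne_zero.isUnit sgn_mul_self sgn_conjTranspose ih rfl rfl

theorem IsAdmissible.seqS_posDef (h : IsAdmissible A S₀ P₀) (k : ℕ) :
    (seqS A S₀ P₀ k).PosDef := by
  induction k with
  | zero => exact h.posDef
  | succ k ih =>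
    have h1 := ih.posSemidef.mul_mul_conjTranspose_same A⁻¹
    have h2 := posSemidef_self_mul_conjTranspose (A⁻¹ * seqP A P₀ k)
    rw [conjTranspose_nonsing_inv] at h1
    rw [conjTranspose_mul, conjTranspose_nonsing_inv, ← Matrix.mul_assoc] at h2
    exact (ih.add_posSemidef h1).add_posSemidef h2

theorem IsStronglyAdmissible.potential_jUnitary (h : IsStronglyAdmissible A S₀ P₀) (k : ℕ) :
    potential A S₀ P₀ k * sgn m₁ m₂ * potential A S₀ P₀ k = sgn m₁ m₂ := by
  have hz := isUnit_one_add_real_smul h.spectrum_upper 1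
  rw [Complex.ofReal_one, one_smul, isUnit_iff_isUnit_det] at hz
  exact step_jUnitary h.det_ne_zero.isUnit sgn_mul_self sgn_conjTranspose
    (h.seqS_posDef k) (h.seqS_posDef (k + 1)) (h.seq_identity k) rfl rfl hz rfl

theorem IsStronglyAdmissible.isDiracPotential (h : IsStronglyAdmissible A S₀ P₀) :
    IsDiracPotential (potential A S₀ P₀) := by
  intro k
  have hj := h.potential_jUnitary k
  refine ⟨?_, hj⟩
  have hpsd : (potential A S₀ P₀ k).PosSemidef :=
    step_posSemidef sgn_mul_self sgn_conjTranspose (h.seqS_posDef k) (h.seqS_posDef (k + 1))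
      rfl rfl
  refine hpsd.posDef_iff_isUnit.2 ?_
  refine IsUnit.of_mul_eq_one (sgn m₁ m₂ * potential A S₀ P₀ k * sgn m₁ m₂) ?_
  rw [← Matrix.mul_assoc, ← Matrix.mul_assoc, hj, sgn_mul_self]

theorem IsStronglyAdmissible.darboux_step (h : IsStronglyAdmissible A S₀ P₀) (z : ℝ) (k : ℕ) :
    darboux A (seqS A S₀ P₀ (k + 1)) (sgn m₁ m₂) (seqP A P₀ (k + 1)) z *
        (1 + (Complex.I * (z : ℂ)) • sgn m₁ m₂) =
      (1 + (Complex.I * (z : ℂ)) • (sgn m₁ m₂ * potential A S₀ P₀ k)) *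
        darboux A (seqS A S₀ P₀ k) (sgn m₁ m₂) (seqP A P₀ k) z :=
  darboux_intertwine h.det_ne_zero.isUnit sgn_mul_self sgn_conjTranspose
    ((isUnit_iff_isUnit_det _).1 (h.seqS_posDef k).isUnit)
    ((isUnit_iff_isUnit_det _).1 (h.seqS_posDef (k + 1)).isUnit) (h.seq_identity k) rfl rfl
    ((isUnit_iff_isUnit_det _).1 (isUnit_one_add_real_smul h.spectrum_upper z))

theorem IsStronglyAdmissible.darboux_unitary (h : IsStronglyAdmissible A S₀ P₀) (z : ℝ) (k : ℕ) :
    (darboux A (seqS A S₀ P₀ k) (sgn m₁ m₂) (seqP A P₀ k) z)ᴴ * sgn m₁ m₂ *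
      darboux A (seqS A S₀ P₀ k) (sgn m₁ m₂) (seqP A P₀ k) z = sgn m₁ m₂ :=
  darboux_jUnitary sgn_mul_self sgn_conjTranspose (h.seqS_posDef k) (h.seq_identity k)
    ((isUnit_iff_isUnit_det _).1 (isUnit_one_add_real_smul h.spectrum_upper z))

end Admissible

/-! ### Decay of the powers of the Cayley transform -/

/-- The Cayley transform `(A + i)⁻¹ (A - i)`. -/
noncomputable def cayley (A : Matrix (Fin n) (Fin n) ℂ) : Matrix (Fin n) (Fin n) ℂ :=
  (A + Complex.I • 1)⁻¹ * (A - Complex.I • 1)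

theorem isUnit_add_I (hA : ∀ μ ∈ spectrum ℂ A, 0 < μ.im) : IsUnit (A + Complex.I • 1) := by
  have := isUnit_linear_of_notMem_spectrum (A := A) (a := Complex.I) (b := 1) one_ne_zero
    fun h => by
      have := hA _ h
      norm_num at this
  simpa [add_comm] using this

/-- The Cayley transform maps the upper half-plane into the unit disc. -/
theorem norm_lt_one_of_mem_spectrum_cayley (hA : ∀ μ ∈ spectrum ℂ A, 0 < μ.im) {l : ℂ}
    (hl : l ∈ spectrum ℂ (cayley A)) : ‖l‖ < 1 := by
  have hu := isUnit_add_I hA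
  have hud := (isUnit_iff_isUnit_det _).1 hu
  -- `l - cayley A` is, up to the unit `A + i`, linear in `A`
  have hfac : (A + Complex.I • 1) * (algebraMap ℂ _ l - cayley A) =
      (Complex.I * (l + 1)) • 1 + (l - 1) • A := by
    rw [Matrix.mul_sub, cayley, Matrix.mul_nonsing_inv_cancel_left _ _ hud,
      Algebra.algebraMap_eq_smul_one, Matrix.mul_smul, Matrix.mul_one]
    module
  by_cases h1 : l = 1
  · exfalso
    refine hl ?_
    have h2 : IsUnit ((A + Complex.I • 1) * (algebraMap ℂ _ l - cayley A)) := by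
      rw [hfac, h1]
      have := (isUnit_one (M := Matrix (Fin n) (Fin n) ℂ)).smul
        (Units.mk0 (Complex.I * (1 + 1)) (by norm_num))
      simpa [Units.smul_def] using this
    exact (IsUnit.mul_iff.1 h2).2
  · have hb : l - 1 ≠ 0 := sub_ne_zero.2 h1
    have hmem : -(Complex.I * (l + 1)) / (l - 1) ∈ spectrum ℂ A := by
      by_contra hn
      refine hl ?_
      have h2 := isUnit_linear_of_notMem_spectrum hb hn
      rw [← hfac] at h2
      exact (IsUnit.mul_iff.1 h2).2
    have him := hA _ hmem
    have hns : 0 < Complex.normSq (l - 1) := Complex.normSq_pos.2 hb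
    have : (-(Complex.I * (l + 1)) / (l - 1)).im =
        (1 - (l.re ^ 2 + l.im ^ 2)) / Complex.normSq (l - 1) := by
      rw [Complex.div_im]
      simp
      ring
    rw [this] at him
    have h3 := (div_pos_iff_of_pos_right hns).1 him
    have h4 : ‖l‖ ^ 2 = l.re ^ 2 + l.im ^ 2 := by
      rw [Complex.sq_norm, Complex.normSq_apply]; ring
    nlinarith [norm_nonneg l]

open scoped Matrix.Norms.L2Operator in
/-- A matrix of spectral radius less than one has geometrically decaying powers, by Gelfand's
formula, so that Stein-type series converge. -/
theorem summable_pow_mul_mul_conjTranspose {V : Matrix (Fin n) (Fin n) ℂ}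
    (hV : ∀ l ∈ spectrum ℂ V, ‖l‖ < 1) (Y : Matrix (Fin n) (Fin n) ℂ) :
    Tendsto (fun k => V ^ k) atTop (𝓝 0) ∧ Summable fun k => V ^ k * Y * (V ^ k)ᴴ := by
  -- if `n = 0` the spectrum is empty and does not attain the spectral radius
  rcases subsingleton_or_nontrivial (Matrix (Fin n) (Fin n) ℂ) with hs | hn
  · refine ⟨?_, ?_⟩
    · rw [show (fun k => V ^ k) = fun _ => 0 from funext fun _ => Subsingleton.elim _ _]
      exact tendsto_const_nhds
    · rw [show (fun k => V ^ k * Y * (V ^ k)ᴴ) = fun _ => 0 from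
        funext fun _ => Subsingleton.elim _ _]
      exact summable_zero
  have hr : spectralRadius ℂ V < (1 : NNReal) :=
    spectrum.spectralRadius_lt_of_forall_lt V fun z hz => by exact_mod_cast hV z hz
  obtain ⟨r, hr1, hr2⟩ := ENNReal.lt_iff_exists_nnreal_btwn.1 hr
  have hr2' : r < 1 := by exact_mod_cast hr2
  have hev :=
    (spectrum.pow_nnnorm_pow_one_div_tendsto_nhds_spectralRadius V).eventually_lt_const hr1
  have hbd : ∀ᶠ k : ℕ in atTop, ‖V ^ k‖ ≤ (r : ℝ) ^ k := by
    filter_upwards [hev, eventually_gt_atTop 0] with k hk hk0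
    have : (‖V ^ k‖₊ : ENNReal) < (r : ENNReal) ^ (k : ℝ) := by
      have h := ENNReal.rpow_lt_rpow hk (by positivity : (0 : ℝ) < k)
      rwa [← ENNReal.rpow_mul, one_div, inv_mul_cancel₀ (Nat.cast_ne_zero.2 hk0.ne'),
        ENNReal.rpow_one] at h
    rw [ENNReal.rpow_natCast] at this
    have h2 : ‖V ^ k‖₊ < r ^ k := by exact_mod_cast this
    exact_mod_cast h2.le
  refine ⟨squeeze_zero_norm' hbd
    (tendsto_pow_atTop_nhds_zero_of_lt_one r.2 (by exact_mod_cast hr2')), ?_⟩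
  have hg : Summable fun k : ℕ => ((r : ℝ) * r) ^ k * ‖Y‖ :=
    (summable_geometric_of_lt_one (mul_nonneg r.2 r.2)
      (mul_lt_one_of_nonneg_of_lt_one_left r.2 (by exact_mod_cast hr2')
        (by exact_mod_cast hr2'.le))).mul_right _
  refine hg.of_norm_bounded_eventually_nat ?_
  filter_upwards [hbd] with k hk
  calc ‖V ^ k * Y * (V ^ k)ᴴ‖ ≤ ‖V ^ k‖ * ‖Y‖ * ‖(V ^ k)ᴴ‖ :=
        (norm_mul_le _ _).trans (mul_le_mul_of_nonneg_right (norm_mul_le _ _) (norm_nonneg _))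
    _ = ‖V ^ k‖ * ‖Y‖ * ‖V ^ k‖ := by rw [Matrix.l2_opNorm_conjTranspose]
    _ ≤ (r : ℝ) ^ k * ‖Y‖ * (r : ℝ) ^ k := by gcongr
    _ = ((r : ℝ) * r) ^ k * ‖Y‖ := by rw [mul_pow]; ring

/-! ### Closed forms and limits of the normalised sequences -/

variable {θ₁ : Matrix (Fin n) (Fin m₁) ℂ} {θ₂ : Matrix (Fin n) (Fin m₂) ℂ}

/-- The growth factor `I + i A⁻¹` of the first block column of `Π_k`. -/
noncomputable def growth (A : Matrix (Fin n) (Fin n) ℂ) : Matrix (Fin n) (Fin n) ℂ :=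
  1 + Complex.I • A⁻¹

theorem growth_eq (hA : IsUnit A.det) : growth A = A⁻¹ * (A + Complex.I • 1) := by
  rw [growth, Matrix.mul_add, Matrix.nonsing_inv_mul _ hA, Matrix.mul_smul, Matrix.mul_one]

theorem isUnit_growth (hA : IsUnit A.det) (hI : IsUnit (A + Complex.I • 1)) :
    IsUnit (growth A) := by
  rw [growth_eq hA]
  exact (Matrix.isUnit_nonsing_inv_iff.2 ((isUnit_iff_isUnit_det _).2 hA)).mul hI

theorem commute_inv_growth : Commute A⁻¹ (growth A) :=
  (Commute.one_right _).add_right ((Commute.refl _).smul_right _)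

theorem commute_growth_self (hA : IsUnit A.det) : Commute (growth A) A := by
  refine (Commute.one_left _).add_left (Commute.smul_left ?_ _)
  rw [Commute, SemiconjBy, Matrix.mul_nonsing_inv _ hA, Matrix.nonsing_inv_mul _ hA]

theorem growth_mul_cayley (hA : IsUnit A.det) (hI : IsUnit (A + Complex.I • 1)) :
    growth A * cayley A = 1 - Complex.I • A⁻¹ := by
  rw [growth_eq hA, cayley, Matrix.mul_assoc,
    Matrix.mul_nonsing_inv_cancel_left _ _ ((isUnit_iff_isUnit_det _).1 hI), Matrix.mul_sub,
    Matrix.nonsing_inv_mul _ hA, Matrix.mul_smul, Matrix.mul_one]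

theorem growth_mul_inv (hA : IsUnit A.det) (hI : IsUnit (A + Complex.I • 1)) :
    growth A * (A + Complex.I • 1)⁻¹ = A⁻¹ := by
  rw [growth_eq hA, Matrix.mul_assoc, Matrix.mul_nonsing_inv _ ((isUnit_iff_isUnit_det _).1 hI),
    Matrix.mul_one]

theorem commute_inv_cayley (hI : IsUnit (A + Complex.I • 1)) :
    Commute (A + Complex.I • 1)⁻¹ (cayley A) := by
  have hc : Commute (A + Complex.I • 1)⁻¹ (A - Complex.I • 1) := by
    have hd := (isUnit_iff_isUnit_det _).1 hI
    have : A - Complex.I • (1 : Matrix (Fin n) (Fin n) ℂ) =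
        (A + Complex.I • 1) - (2 * Complex.I) • 1 := by module
    rw [this]
    refine Commute.sub_right ?_ ((Commute.one_right _).smul_right _)
    rw [Commute, SemiconjBy, Matrix.mul_nonsing_inv _ hd, Matrix.nonsing_inv_mul _ hd]
  exact (Commute.refl _).mul_right hc

theorem seqP_eq (hA : IsUnit A.det) (hI : IsUnit (A + Complex.I • 1)) (k : ℕ) :
    seqP A (fromCols θ₁ θ₂) k = growth A ^ k * fromCols θ₁ (cayley A ^ k * θ₂) := by
  induction k with
  | zero => simp [seqP]
  | succ k ih =>
    have h1 : seqP A (fromCols θ₁ θ₂) (k + 1) = growth A ^ k * (fromCols θ₁ (cayley A ^ k * θ₂) +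
        Complex.I • (A⁻¹ * (fromCols θ₁ (cayley A ^ k * θ₂) * sgn m₁ m₂))) := by
      rw [seqP, ih, ← Matrix.mul_assoc A⁻¹, (commute_inv_growth.pow_right k).eq]
      simp only [Matrix.mul_add, Matrix.mul_smul, Matrix.mul_assoc]
    rw [h1, pow_succ (growth A), Matrix.mul_assoc, fromCols_mul_sgn]
    congr 1
    rw [mul_fromCols, mul_fromCols, pow_succ' (cayley A), ← Matrix.mul_assoc,
      ← Matrix.mul_assoc, growth_mul_cayley hA hI]
    ext i (j | j)
    · simp [growth, Matrix.add_mul]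
    · simp [sub_eq_add_neg, Matrix.add_mul, Matrix.mul_assoc]

/-- The sequence `S_k` normalised by the growth factor: `S_k = B ^ k * normS k * (B ^ k)ᴴ` with
`B = growth A`. -/
noncomputable def normS (A S₀ : Matrix (Fin n) (Fin n) ℂ) (θ₂ : Matrix (Fin n) (Fin m₂) ℂ)
    (k : ℕ) : Matrix (Fin n) (Fin n) ℂ :=
  S₀ + ∑ i ∈ Finset.range k, (cayley A ^ i *
    ((2 : ℂ) • ((A + Complex.I • 1)⁻¹ * θ₂ * ((A + Complex.I • 1)⁻¹ * θ₂)ᴴ)) * (cayley A ^ i)ᴴ)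

/-- By the matrix identity, a step of the `S`-recursion is congruence by the growth factor plus a
positive semidefinite increment coming from the second block column only. -/
theorem seqS_step_eq (hA : IsUnit A.det) {S : Matrix (Fin n) (Fin n) ℂ}
    {X : Matrix (Fin n) (Fin m₁) ℂ} {Y : Matrix (Fin n) (Fin m₂) ℂ}
    (hid : A * S - S * Aᴴ = Complex.I • (fromCols X Y * sgn m₁ m₂ * (fromCols X Y)ᴴ)) :
    S + A⁻¹ * S * (Aᴴ)⁻¹ + A⁻¹ * fromCols X Y * (fromCols X Y)ᴴ * (Aᴴ)⁻¹ =
      growth A * S * (growth A)ᴴ + (2 : ℂ) • (A⁻¹ * Y * (A⁻¹ * Y)ᴴ) := by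
  have hAs : IsUnit (Aᴴ).det := by rw [det_conjTranspose]; exact hA.star
  rw [fromCols_mul_sgn, conjTranspose_fromCols_eq_fromRows_conjTranspose,
    fromCols_mul_fromRows] at hid
  have hid2 := congrArg (fun M => A⁻¹ * M * (Aᴴ)⁻¹) hid
  rw [conjTranspose_fromCols_eq_fromRows_conjTranspose, Matrix.mul_assoc A⁻¹ (fromCols X Y),
    fromCols_mul_fromRows]
  linear_combination (norm := skip) Complex.I • hid2
  simp only [growth, Matrix.mul_add, Matrix.add_mul, Matrix.mul_sub, Matrix.sub_mul,
    Matrix.mul_assoc, Matrix.smul_mul, Matrix.mul_smul, smul_add, smul_smul, smul_sub,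
    conjTranspose_add, conjTranspose_smul, conjTranspose_mul, conjTranspose_nonsing_inv,
    conjTranspose_one, Matrix.nonsing_inv_mul_cancel_left _ _ hA, Matrix.neg_mul, Matrix.mul_neg,
    Matrix.mul_nonsing_inv _ hAs, Matrix.mul_one, Matrix.one_mul,
    Complex.star_def, Complex.conj_I]
  have hI : Complex.I ^ 2 = -1 := Complex.I_sq
  match_scalars <;> grind

theorem seqS_eq (h : IsAdmissible A S₀ (fromCols θ₁ θ₂)) (hI : IsUnit (A + Complex.I • 1))
    (k : ℕ) :
    seqS A S₀ (fromCols θ₁ θ₂) k = growth A ^ k * normS A S₀ θ₂ k * (growth A ^ k)ᴴ := by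
  have hA := h.det_ne_zero.isUnit
  induction k with
  | zero => simp [seqS, normS]
  | succ k ih =>
    have hid := h.seq_identity k
    rw [seqP_eq hA hI, mul_fromCols] at hid
    have hY : A⁻¹ * (growth A ^ k * (cayley A ^ k * θ₂)) =
        growth A ^ (k + 1) * (cayley A ^ k * ((A + Complex.I • 1)⁻¹ * θ₂)) := by
      rw [← Matrix.mul_assoc, (commute_inv_growth.pow_right k).eq, ← growth_mul_inv hA hI,
        pow_succ (growth A)]
      simp only [← Matrix.mul_assoc]
      rw [Matrix.mul_assoc _ _ (cayley A ^ k), ((commute_inv_cayley hI).pow_right k).eq]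
      simp only [← Matrix.mul_assoc]
    rw [seqS, seqP_eq hA hI, mul_fromCols, seqS_step_eq hA hid, hY, ih, normS, normS,
      Finset.sum_range_succ, pow_succ' (growth A)]
    simp only [conjTranspose_mul, Matrix.mul_add, Matrix.add_mul, Matrix.mul_smul,
      Matrix.smul_mul, Matrix.mul_assoc, add_assoc]

theorem posSemidef_of_tendsto {ι : Type*} [Fintype ι] {M : ℕ → Matrix ι ι ℂ} {L : Matrix ι ι ℂ}
    (hM : ∀ k, (M k).PosSemidef) (hL : Tendsto M atTop (𝓝 L)) : L.PosSemidef := by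
  refine .of_dotProduct_mulVec_nonneg ?_ fun x => ?_
  · refine tendsto_nhds_unique ((continuous_id.matrix_conjTranspose.tendsto L).comp hL) ?_
    refine hL.congr fun k => ?_
    exact ((hM k).isHermitian.eq).symm
  · have hc : Continuous fun M : Matrix ι ι ℂ => star x ⬝ᵥ M *ᵥ x := by fun_prop
    exact ge_of_tendsto' ((hc.tendsto L).comp hL) fun k => (hM k).dotProduct_mulVec_nonneg x

theorem exists_tendsto_normS (hA : ∀ μ ∈ spectrum ℂ A, 0 < μ.im) (hS : S₀.PosDef)
    (θ₂ : Matrix (Fin n) (Fin m₂) ℂ) :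
    ∃ Q : Matrix (Fin n) (Fin n) ℂ, Q.PosDef ∧ Tendsto (normS A S₀ θ₂) atTop (𝓝 Q) := by
  obtain ⟨T, hT⟩ := (summable_pow_mul_mul_conjTranspose
    (fun l hl => norm_lt_one_of_mem_spectrum_cayley hA hl)
    ((2 : ℂ) • ((A + Complex.I • 1)⁻¹ * θ₂ * ((A + Complex.I • 1)⁻¹ * θ₂)ᴴ))).2
  refine ⟨S₀ + T, hS.add_posSemidef ?_, tendsto_const_nhds.add hT.tendsto_sum_nat⟩
  refine posSemidef_of_tendsto (fun k => ?_) hT.tendsto_sum_nat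
  refine posSemidef_sum _ fun i _ => PosSemidef.mul_mul_conjTranspose_same ?_ _
  exact (posSemidef_self_mul_conjTranspose _).smul (by norm_num)

/-! ### Solutions with free asymptotics -/

theorem tendsto_diagonal_conj {κ : Type*} [Fintype κ] [DecidableEq κ] {d : κ → ℂ}
    (hd : ∀ a b, ‖d a‖ = ‖d b‖) {M : ℕ → Matrix κ κ ℂ} (hM : Tendsto M atTop (𝓝 0)) :
    Tendsto (fun k => diagonal d⁻¹ ^ k * M k * diagonal d ^ k) atTop (𝓝 0) := by
  refine tendsto_pi_nhds.2 fun a => tendsto_pi_nhds.2 fun b => ?_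
  have hab : Tendsto (fun k => ‖M k a b‖) atTop (𝓝 0) := by
    simpa using ((tendsto_pi_nhds.1 (tendsto_pi_nhds.1 hM a)) b).norm
  refine squeeze_zero_norm (fun k => ?_) hab
  rw [diagonal_pow, diagonal_pow, mul_diagonal, diagonal_mul, norm_mul, norm_mul]
  simp only [Pi.pow_apply, Pi.inv_apply, norm_pow, norm_inv, hd b a]
  rw [mul_right_comm, ← mul_pow]
  refine mul_le_of_le_one_left (norm_nonneg _) (pow_le_one₀ (by positivity) ?_)
  exact inv_mul_le_one

section Jost

variable {κ : Type*} [Fintype κ] [DecidableEq κ] {d : κ → ℂ}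
  {W M : ℕ → Matrix κ κ ℂ} {L : Matrix κ κ ℂ}

/-- If `W k → L` with `L` invertible and commuting with `diagonal d`, then
`W k * (diagonal d) ^ k * L⁻¹` has free asymptotics. The hypothesis that the entries of `d` have
equal modulus keeps conjugation by `(diagonal d) ^ k` bounded. -/
theorem exists_asymptotics (hd0 : ∀ a, d a ≠ 0) (hd : ∀ a b, ‖d a‖ = ‖d b‖)
    (hW : Tendsto W atTop (𝓝 L)) (hL : IsUnit L) (hLd : Commute L (diagonal d)) :
    ∃ E : ℕ → Matrix κ κ ℂ, Tendsto E atTop (𝓝 0) ∧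
      ∀ k, W k * diagonal d ^ k * L⁻¹ = diagonal d ^ k * (1 + E k) := by
  have hLu := (isUnit_iff_isUnit_det _).1 hL
  have hdd : diagonal d * diagonal d⁻¹ = 1 := by
    rw [diagonal_mul_diagonal, ← diagonal_one]
    exact congrArg diagonal (funext fun a => mul_inv_cancel₀ (hd0 a))
  have hc : Commute (diagonal d) (diagonal d⁻¹) := commute_diagonal _ _
  have h0 : Tendsto (fun k => W k - L) atTop (𝓝 0) := by
    simpa using hW.sub_const L
  refine ⟨fun k => diagonal d⁻¹ ^ k * (W k - L) * diagonal d ^ k * L⁻¹, ?_, fun k => ?_⟩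
  · have hcont : Continuous fun X : Matrix κ κ ℂ => X * L⁻¹ := by fun_prop
    simpa [Function.comp_def] using (hcont.tendsto 0).comp (tendsto_diagonal_conj hd h0)
  · have hk : diagonal d ^ k * diagonal d⁻¹ ^ k = 1 := by
      rw [← hc.mul_pow, hdd, one_pow]
    simp only [Matrix.mul_add, Matrix.mul_one, ← Matrix.mul_assoc, hk, Matrix.one_mul,
      Matrix.sub_mul, (hLd.pow_right k).eq]
    rw [Matrix.mul_nonsing_inv_cancel_right _ _ hLu]
    abel

/-- If `W` intertwines the free system with factor `diagonal d` and the system with factors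
`M k`, and `W k → L`, then the only solution with free asymptotics is
`W k * (diagonal d) ^ k * L⁻¹`. -/
theorem eq_of_asymptotics (hd0 : ∀ a, d a ≠ 0) (hd : ∀ a b, ‖d a‖ = ‖d b‖)
    (hW : Tendsto W atTop (𝓝 L)) (hL : IsUnit L) (hLd : Commute L (diagonal d))
    (hstep : ∀ k, W (k + 1) * diagonal d = M k * W k) (hW0 : IsUnit (W 0))
    {F E : ℕ → Matrix κ κ ℂ} (hF : ∀ k, F (k + 1) = M k * F k) (hE : Tendsto E atTop (𝓝 0))
    (hFE : ∀ k, F k = diagonal d ^ k * (1 + E k)) (k : ℕ) :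
    F k = W k * diagonal d ^ k * L⁻¹ := by
  have hW0u := (isUnit_iff_isUnit_det _).1 hW0
  have hLu := (isUnit_iff_isUnit_det _).1 hL
  obtain ⟨N, hN⟩ : ∃ N, N = (W 0)⁻¹ * F 0 := ⟨_, rfl⟩
  have hFW : ∀ k, F k = W k * diagonal d ^ k * N := by
    intro k
    induction k with
    | zero => rw [hN, pow_zero, Matrix.mul_one, Matrix.mul_nonsing_inv_cancel_left _ _ hW0u]
    | succ k ih =>
      rw [hF, ih, pow_succ', ← Matrix.mul_assoc (W (k + 1)), hstep]
      simp only [Matrix.mul_assoc]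
  obtain ⟨E', hE', hWE'⟩ := exists_asymptotics hd0 hd hW hL hLd
  have hu : ∀ k, IsUnit (diagonal d ^ k) := fun k =>
    (isUnit_diagonal.2 (Pi.isUnit_iff.2 fun a => (hd0 a).isUnit)).pow k
  -- both asymptotic forms force `L * N = 1`
  have hEE : ∀ k, 1 + E k = (1 + E' k) * (L * N) := by
    intro k
    refine (hu k).mul_left_cancel ?_
    rw [← hFE, ← Matrix.mul_assoc, ← hWE', hFW k, ← Matrix.mul_assoc _ L,
      Matrix.nonsing_inv_mul_cancel_right _ _ hLu]
  have h1 : Tendsto (fun k => 1 + E k) atTop (𝓝 (1 + 0)) := hE.const_add 1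
  have hcont : Continuous fun X : Matrix κ κ ℂ => (1 + X) * (L * N) := by fun_prop
  have h2 : Tendsto (fun k => 1 + E k) atTop (𝓝 ((1 + 0) * (L * N))) := by
    simp only [hEE]
    exact (hcont.tendsto 0).comp hE'
  have hLN : L * N = 1 := by
    simpa using (tendsto_nhds_unique h1 h2).symm
  rw [hFW k, Matrix.inv_eq_right_inv hLN]

end Jost

/-! ### The Jost solution and the reflection coefficient -/

theorem darboux_fromCols (S : Matrix (Fin n) (Fin n) ℂ) (X : Matrix (Fin n) (Fin m₁) ℂ)
    (Y : Matrix (Fin n) (Fin m₂) ℂ) (z : ℂ) :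
    darboux A S (sgn m₁ m₂) (fromCols X Y) z =
      fromBlocks (1 - (Complex.I * z) • (Xᴴ * S⁻¹ * (1 + z • A)⁻¹ * X))
        (-((Complex.I * z) • (Xᴴ * S⁻¹ * (1 + z • A)⁻¹ * Y)))
        ((Complex.I * z) • (Yᴴ * S⁻¹ * (1 + z • A)⁻¹ * X))
        (1 + (Complex.I * z) • (Yᴴ * S⁻¹ * (1 + z • A)⁻¹ * Y)) := by
  rw [darboux, conjTranspose_fromCols_eq_fromRows_conjTranspose, fromRows_mul, fromRows_mul,
    fromRows_mul_fromCols, sgn, fromBlocks_multiply, fromBlocks_smul, ← fromBlocks_one,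
    sub_eq_add_neg, fromBlocks_neg, fromBlocks_add]
  simp [sub_eq_add_neg]

theorem free_factor_eq_diagonal (z : ℂ) :
    1 + (Complex.I * z) • sgn m₁ m₂ =
      diagonal (Sum.elim (fun _ => 1 + Complex.I * z) (fun _ => 1 - Complex.I * z)) := by
  rw [← fromBlocks_diagonal, sgn, fromBlocks_smul, ← fromBlocks_one, fromBlocks_add]
  congr 1
  · ext i j
    by_cases hij : i = j <;> simp [hij]
  · simp
  · simp
  · ext i j
    by_cases hij : i = j <;> simp [hij, sub_eq_add_neg]

/-- Existence and uniqueness of the Jost solution at `z`. Its value at `0` is the Darboux matrix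
`w₀(z)` times a block diagonal factor with lower right block `1`, which does not affect the
reflection coefficient. -/
theorem IsStronglyAdmissible.exists_jost
    (h : IsStronglyAdmissible A S₀ (fromCols θ₁ θ₂)) (z : ℝ) :
    ∃ a : Matrix (Fin m₁) (Fin m₁) ℂ, ∃ Y : ℕ → Matrix (Fin m₁ ⊕ Fin m₂) (Fin m₁ ⊕ Fin m₂) ℂ,
      Y 0 = darboux A S₀ (sgn m₁ m₂) (fromCols θ₁ θ₂) z * fromBlocks a 0 0 1 ∧
      IsDiracSolution (potential A S₀ (fromCols θ₁ θ₂)) z Y ∧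
      (∃ E : ℕ → Matrix (Fin m₁ ⊕ Fin m₂) (Fin m₁ ⊕ Fin m₂) ℂ, Tendsto E atTop (𝓝 0) ∧
        ∀ k, Y k = (1 + (Complex.I * (z : ℂ)) • sgn m₁ m₂) ^ k * (1 + E k)) ∧
      ∀ F E : ℕ → Matrix (Fin m₁ ⊕ Fin m₂) (Fin m₁ ⊕ Fin m₂) ℂ,
        IsDiracSolution (potential A S₀ (fromCols θ₁ θ₂)) z F → Tendsto E atTop (𝓝 0) →
        (∀ k, F k = (1 + (Complex.I * (z : ℂ)) • sgn m₁ m₂) ^ k * (1 + E k)) → F = Y := by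
  have hA := h.det_ne_zero.isUnit
  have hI := isUnit_add_I h.spectrum_upper
  obtain ⟨Q, hQ, hQt⟩ := exists_tendsto_normS h.spectrum_upper h.posDef θ₂
  set W : ℕ → Matrix (Fin m₁ ⊕ Fin m₂) (Fin m₁ ⊕ Fin m₂) ℂ := fun k =>
    darboux A (seqS A S₀ (fromCols θ₁ θ₂) k) (sgn m₁ m₂) (seqP A (fromCols θ₁ θ₂) k) z with hWdef
  obtain ⟨b, hb⟩ : ∃ b, b = 1 - (Complex.I * z) • (θ₁ᴴ * Q⁻¹ * (1 + (z : ℂ) • A)⁻¹ * θ₁) :=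
    ⟨_, rfl⟩
  set L : Matrix (Fin m₁ ⊕ Fin m₂) (Fin m₁ ⊕ Fin m₂) ℂ := fromBlocks b 0 0 1 with hLdef
  have hWt : Tendsto W atTop (𝓝 L) := by
    have hW : W = fun k => darboux A (normS A S₀ θ₂ k) (sgn m₁ m₂)
        (fromCols θ₁ (cayley A ^ k * θ₂)) z := by
      funext k
      simp only [hWdef]
      rw [seqP_eq hA hI, seqS_eq h.toIsAdmissible hI]
      exact darboux_conj ((isUnit_growth hA hI).pow k) ((commute_growth_self hA).pow_left k)
        (isUnit_one_add_real_smul h.spectrum_upper z)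
    have hL : L = darboux A Q (sgn m₁ m₂) (fromCols θ₁ 0) z := by
      rw [darboux_fromCols, hLdef, hb]
      simp
    rw [hW, hL]
    refine darboux_tendsto ((isUnit_iff_isUnit_det _).1 hQ.isUnit) hQt ?_ z
    have hV := (summable_pow_mul_mul_conjTranspose
      (fun l hl => norm_lt_one_of_mem_spectrum_cayley h.spectrum_upper hl) 1).1
    have hc : Continuous fun V : Matrix (Fin n) (Fin n) ℂ => fromCols θ₁ (V * θ₂) := by
      refine continuous_matrix fun i j => ?_
      rcases j with j | j
      · simpa using continuous_const
      · simp only [fromCols_apply_inr]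
        fun_prop
    simpa [Function.comp_def] using (hc.tendsto 0).comp hV
  -- the limit inherits `j`-unitarity, which also exhibits its inverse
  have hLj : Lᴴ * sgn m₁ m₂ * L = sgn m₁ m₂ := by
    have hc : Continuous fun X : Matrix (Fin m₁ ⊕ Fin m₂) (Fin m₁ ⊕ Fin m₂) ℂ =>
      Xᴴ * sgn m₁ m₂ * X := by fun_prop
    refine tendsto_nhds_unique ((hc.tendsto L).comp hWt) ?_
    exact tendsto_const_nhds.congr fun k => (h.darboux_unitary z k).symm
  have hLu : IsUnit L := isUnit_of_jUnitary sgn_mul_self hLj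
  have hLinv : L⁻¹ = fromBlocks bᴴ 0 0 1 := by
    refine Matrix.inv_eq_left_inv ?_
    have h1 : fromBlocks bᴴ 0 0 1 = sgn m₁ m₂ * Lᴴ * sgn m₁ m₂ := by
      simp [hLdef, sgn, fromBlocks_conjTranspose, fromBlocks_multiply]
    rw [h1, Matrix.mul_assoc, Matrix.mul_assoc, ← Matrix.mul_assoc Lᴴ, hLj, sgn_mul_self]
  have hstep := h.darboux_step z
  have hLd : Commute L (1 + (Complex.I * (z : ℂ)) • sgn m₁ m₂) := by
    refine (Commute.one_right _).add_right (Commute.smul_right ?_ _)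
    simp [Commute, SemiconjBy, hLdef, sgn, fromBlocks_multiply]
  set d : Fin m₁ ⊕ Fin m₂ → ℂ :=
    Sum.elim (fun _ => 1 + Complex.I * z) (fun _ => 1 - Complex.I * z) with hd
  rw [free_factor_eq_diagonal, ← hd] at hLd ⊢
  simp only [free_factor_eq_diagonal, ← hd] at hstep
  have hne1 : 1 + Complex.I * (z : ℂ) ≠ 0 := fun h0 => by
    simpa using congrArg Complex.re h0
  have hne2 : 1 - Complex.I * (z : ℂ) ≠ 0 := fun h0 => by
    simpa using congrArg Complex.re h0
  have hnorm : ‖1 + Complex.I * (z : ℂ)‖ = ‖1 - Complex.I * (z : ℂ)‖ := by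
    rw [← Complex.norm_conj]
    simp [sub_eq_add_neg]
  have hd0 : ∀ a, d a ≠ 0 := by
    rintro (a | a)
    · exact hne1
    · exact hne2
  have hdn : ∀ a b, ‖d a‖ = ‖d b‖ := by
    rintro (a | a) (b | b)
    · rfl
    · exact hnorm
    · exact hnorm.symm
    · rfl
  refine ⟨bᴴ, fun k => W k * diagonal d ^ k * L⁻¹, ?_, ?_,
    exists_asymptotics hd0 hdn hWt hLu hLd, fun F E hF hE hFE => funext fun k => ?_⟩
  · simp only [pow_zero, Matrix.mul_one, hLinv]
    rfl
  · intro k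
    simp only [pow_succ']
    rw [← Matrix.mul_assoc (W (k + 1)), hstep k]
    simp only [Matrix.mul_assoc]
    rfl
  · exact eq_of_asymptotics hd0 hdn hWt hLu hLd hstep
      (isUnit_of_jUnitary sgn_mul_self (h.darboux_unitary z 0)) hF hE hFE k

/-- The lower right block of a `j`-unitary matrix is expansive, hence invertible. -/
theorem isUnit_toBlocks₂₂_of_jUnitary {W : Matrix (Fin m₁ ⊕ Fin m₂) (Fin m₁ ⊕ Fin m₂) ℂ}
    (hW : Wᴴ * sgn m₁ m₂ * W = sgn m₁ m₂) : IsUnit W.toBlocks₂₂ := by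
  have h22 : W.toBlocks₂₂ᴴ * W.toBlocks₂₂ = 1 + W.toBlocks₁₂ᴴ * W.toBlocks₁₂ := by
    rw [← fromBlocks_toBlocks W, sgn, fromBlocks_conjTranspose, fromBlocks_multiply,
      fromBlocks_multiply, fromBlocks_inj] at hW
    have := hW.2.2.2
    simp only [Matrix.mul_zero, Matrix.mul_one, add_zero, zero_add, Matrix.mul_neg,
      Matrix.neg_mul] at this
    linear_combination (norm := module) -this
  have hpd : (W.toBlocks₂₂ᴴ * W.toBlocks₂₂).PosDef := by
    rw [h22]
    exact PosDef.one.add_posSemidef (posSemidef_conjTranspose_mul_self _)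
  exact (IsUnit.mul_iff.1 hpd.isUnit).2

/-- A perturbation `E + U R` of an invertible matrix is controlled by `1 + R E⁻¹ U`
(a form of the Woodbury identity). -/
theorem isUnit_add_mul_and_inv_mul {ι κ : Type*} [Fintype ι] [DecidableEq ι] [Fintype κ]
    [DecidableEq κ] {E : Matrix ι ι ℂ} {U : Matrix ι κ ℂ} {R : Matrix κ ι ℂ} (hE : IsUnit E)
    (hw : IsUnit (1 + R * E⁻¹ * U)) :
    IsUnit (E + U * R) ∧ (E + U * R)⁻¹ * U = E⁻¹ * U * (1 + R * E⁻¹ * U)⁻¹ := by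
  have hEd := (isUnit_iff_isUnit_det _).1 hE
  have hwd := (isUnit_iff_isUnit_det _).1 hw
  have hu : IsUnit (E + U * R) := by
    have hfac : E + U * R = (1 + U * (R * E⁻¹)) * E := by
      rw [Matrix.add_mul, Matrix.one_mul, Matrix.mul_assoc, Matrix.mul_assoc,
        Matrix.nonsing_inv_mul _ hEd, Matrix.mul_one]
    rw [hfac, isUnit_iff_isUnit_det, det_mul, det_one_add_mul_comm]
    exact hwd.mul hEd
  refine ⟨hu, ?_⟩
  have hud := (isUnit_iff_isUnit_det _).1 hu
  have key : (E + U * R) * (E⁻¹ * U * (1 + R * E⁻¹ * U)⁻¹) = U := by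
    have h1 : (E + U * R) * (E⁻¹ * U) = U * (1 + R * E⁻¹ * U) := by
      rw [Matrix.add_mul, Matrix.mul_nonsing_inv_cancel_left _ _ hEd]
      simp only [Matrix.mul_add, Matrix.mul_one, Matrix.mul_assoc]
    rw [← Matrix.mul_assoc, h1, Matrix.mul_nonsing_inv_cancel_right _ _ hwd]
  calc (E + U * R)⁻¹ * U
      = (E + U * R)⁻¹ * ((E + U * R) * (E⁻¹ * U * (1 + R * E⁻¹ * U)⁻¹)) := by rw [key]
    _ = _ := Matrix.nonsing_inv_mul_cancel_left _ _ hud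

end DiscreteDirac

theorem corollary3p2 (n m₁ m₂ : ℕ)
    (A S₀ : Matrix (Fin n) (Fin n) ℂ)
    (θ₁ : Matrix (Fin n) (Fin m₁) ℂ) (θ₂ : Matrix (Fin n) (Fin m₂) ℂ)
    (h : DiscreteDirac.IsStronglyAdmissible A S₀ (Matrix.fromCols θ₁ θ₂)) :
    -- the potential is well defined and yields a self-adjoint discrete Dirac system
    (∀ k, (DiscreteDirac.seqS A S₀ (Matrix.fromCols θ₁ θ₂) k).PosDef) ∧
    DiscreteDirac.IsDiracPotential
      (DiscreteDirac.potential A S₀ (Matrix.fromCols θ₁ θ₂)) ∧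
    -- the Jost solution exists and is unique
    (∃! F, DiscreteDirac.IsJostSolution
      (DiscreteDirac.potential A S₀ (Matrix.fromCols θ₁ θ₂)) F) ∧
    -- the reflection coefficient is well defined and given by the explicit formula
    ∀ F, DiscreteDirac.IsJostSolution
        (DiscreteDirac.potential A S₀ (Matrix.fromCols θ₁ θ₂)) F →
      ∀ z : ℝ,
        IsUnit (F z 0).toBlocks₂₂ ∧
        IsUnit (1 + (z : ℂ) • (A + Complex.I • (θ₂ * θ₂ᴴ * S₀⁻¹))) ∧
        DiscreteDirac.reflectionCoefficient F z =
          (-(Complex.I * (z : ℂ))) • (θ₁ᴴ * S₀⁻¹ *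
            (1 + (z : ℂ) • (A + Complex.I • (θ₂ * θ₂ᴴ * S₀⁻¹)))⁻¹ * θ₂) := by
  refine ⟨h.seqS_posDef, h.isDiracPotential, ?_, ?_⟩
  · choose a Y hY0 hYs hYa hYu using h.exists_jost
    refine ⟨Y, fun z => ⟨hYs z, hYa z⟩, fun F hF => funext fun z => ?_⟩
    obtain ⟨hFs, E, hE, hFE⟩ := hF z
    exact hYu z (F z) E hFs hE hFE
  · intro F hF z
    obtain ⟨a, Y, hY0, -, -, hYu⟩ := h.exists_jost z
    obtain ⟨hFs, E, hE, hFE⟩ := hF z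
    have hF0 : F z 0 = DiscreteDirac.darboux A S₀ (DiscreteDirac.sgn m₁ m₂) (fromCols θ₁ θ₂) z *
        fromBlocks a 0 0 1 := by
      rw [hYu (F z) E hFs hE hFE, hY0]
    have hw := DiscreteDirac.isUnit_toBlocks₂₂_of_jUnitary (h.darboux_unitary z 0)
    simp only [DiscreteDirac.seqS, DiscreteDirac.seqP] at hw
    rw [DiscreteDirac.darboux_fromCols] at hF0 hw
    rw [toBlocks_fromBlocks₂₂] at hw
    rw [fromBlocks_multiply] at hF0
    simp only [Matrix.mul_zero, Matrix.mul_one, zero_add] at hF0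
    have hfac : 1 + (Complex.I * (z : ℂ)) • (θ₂ᴴ * S₀⁻¹ * (1 + (z : ℂ) • A)⁻¹ * θ₂) =
        1 + (Complex.I * (z : ℂ)) • (θ₂ᴴ * S₀⁻¹) * (1 + (z : ℂ) • A)⁻¹ * θ₂ := by
      simp only [Matrix.smul_mul]
    have hAx : 1 + (z : ℂ) • (A + Complex.I • (θ₂ * θ₂ᴴ * S₀⁻¹)) =
        1 + (z : ℂ) • A + θ₂ * ((Complex.I * (z : ℂ)) • (θ₂ᴴ * S₀⁻¹)) := by
      rw [Matrix.mul_smul, Matrix.mul_assoc]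
      module
    have hw' := hw
    rw [hfac] at hw'
    obtain ⟨hu, hinv⟩ := DiscreteDirac.isUnit_add_mul_and_inv_mul
      (DiscreteDirac.isUnit_one_add_real_smul h.spectrum_upper z) hw'
    rw [← hAx] at hu hinv
    refine ⟨by rw [hF0, toBlocks_fromBlocks₂₂]; exact hw, hu, ?_⟩
    rw [DiscreteDirac.reflectionCoefficient, hF0, toBlocks_fromBlocks₁₂, toBlocks_fromBlocks₂₂,
      hfac, Matrix.mul_assoc (θ₁ᴴ * S₀⁻¹) _ θ₂,
      Matrix.mul_assoc (θ₁ᴴ * S₀⁻¹) _ θ₂, hinv]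
    simp only [Matrix.neg_mul, Matrix.smul_mul, neg_smul, Matrix.mul_assoc]
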